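/- Let $\lambda>0$, $\alpha>2$, $h>0$, $r>0$ and $s\ge 0$. Let $\Phi=\{x_i\}\subset\mathbb R^2$ be a homogeneous Poisson point process of density $\lambda$ (the horizontal locations of the base stations), and let the fading gains $g_{x_i}$ be i.i.d. exponential random variables of mean $1$, independent of $\Phi$ (Rayleigh fading). For $t\ge0$ and a base station height $H\in\{0,h\}$ let $\ell(t,H)=(t^2+H^2)^{-\alpha/2}$. Given that the serving base station is at horizontal distance $r$ from the origin, the interfering base stations are distributed as the points of $\Phi$ at horizontal distance at least $\nu(r)$, where $\nu(r)=r$ for closest and $\nu(r)=0$ for strongest association; thus the interference is $I_H=\sum_{y\in\Phi,\ \|y\|\ge\nu(r)} g_y\,\ell(\|y\|,H)$. Its Laplace transform $\mathbb E[e^{-sI_H}]$ is denoted by $\mathcal L^{(\mathrm C)}_{I}(s)$ for closest and by $\mathcal L^{(\mathrm S)}_{I}(s)$ for strongest association if $H=h$ (elevated base stations), and by $\mathcal L^{\mathrm{NLOS},(\mathrm C)}_{I}(s)$ and $\mathcal L^{\mathrm{NLOS},(\mathrm S)}_{I}(s)$ if $H=0$ (non-elevated base stations). Put $$\eta(s,m,r)={}_2F_1\Big(m,-\tfrac2\alpha;1-\tfrac2\alpha;-\tfrac{s}{m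 r^{\alpha}}\Big),\qquad \zeta(m)=-\frac{\Gamma(m+\frac2\alpha)\,\Gamma(-\frac2\alpha)}{\alpha\,\Gamma(m)},$$ where ${}_2F_1$ is the Gauss hypergeometric function on $\mathbb C\setminus[1,\infty)$ (the analytic continuation of the hypergeometric series). Then all these interference sums are almost surely finite, and the following hold. (i) With non-elevated base stations, $$\mathcal L^{\mathrm{NLOS},(\mathrm C)}_{I}(s)=\exp\big(-\pi\lambda r^2(\eta(s,1,r)-1)\big),\qquad \mathcal L^{\mathrm{NLOS},(\mathrm S)}_{I}(s)=\exp\big(-2\pi\lambda\,\zeta(1)\,s^{2/\alpha}\big).$$ (ii) With elevated base stations, for both association policies, $$\mathbb E[e^{-sI_h}]=\exp\Big(-2\pi\lambda\int_{\nu(r)}^\infty\Big(1-\frac1{1+s\,\ell(t,h)}\Big)t\,\mathrm dt\Big).$$ (iii) For closest association, $$\mathcal L^{(\mathrm C)}_{I}(s)=\mathcal L^{\mathrm{NLOS},(\mathrm C)}_{I}(s)\,\exp\Big(2\pi\lambda\int_r^{\sqrt{r^2+h^2}}\Big(1-\frac1{1+s t^{-\alpha}}\Big)t\,\mathrm dt\Big)=\exp\Big(-\pi\lambda(r^2+h^2)\big(\eta(s,1,\sqrt{r^2+h^2})-1\big)\Big).$$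 (iv) For strongest association, $$\mathcal L^{(\mathrm S)}_{I}(s)=\mathcal L^{\mathrm{NLOS},(\mathrm S)}_{I}(s)\,\exp\Big(2\pi\lambda\int_0^{h}\Big(1-\frac1{1+s t^{-\alpha}}\Big)t\,\mathrm dt\Big)=\exp\Big(-\pi\lambda h^2\big(\eta(s,1,h)-1\big)\Big).$$ -/

import Mathlib

open MeasureTheory ProbabilityTheory
open scoped ENNReal NNReal

noncomputable section

namespace ElevatedBS

/-! ### The Gauss hypergeometric function on the cut plane -/

/-- The complex plane without the ray `[1, ∞)`. -/
def cutPlane : Set ℂ := {z | 1 - z ∈ Complex.slitPlane}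

/-- `F` is the principal branch of the Gauss hypergeometric function `₂F₁(a, b; c; ·)`: it is
holomorphic on the plane cut along `[1, ∞)` and is the sum of the hypergeometric series on the
open unit disc. -/
def IsGaussHypergeometric (a b c : ℂ) (F : ℂ → ℂ) : Prop :=
  DifferentiableOn ℂ F cutPlane ∧ ∀ z ∈ Metric.ball (0 : ℂ) 1, F z = ₂F₁ a b c z

open Classical in
/-- The Gauss hypergeometric function on the cut plane, i.e. the analytic continuation of the
hypergeometric series. (Mathlib's `₂F₁` is the sum of the series only, with the value `0` outside
the disc of convergence, whereas here the argument ranges over the whole negative half-line.) -/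
def gaussHypergeometric (a b c z : ℂ) : ℂ :=
  if H : ∃ F : ℂ → ℂ, IsGaussHypergeometric a b c F then H.choose z else 0

lemma isOpen_cutPlane : IsOpen cutPlane :=
  Complex.isOpen_slitPlane.preimage (by fun_prop)

lemma isPreconnected_cutPlane : IsPreconnected cutPlane := by
  have h1 : IsPreconnected Complex.slitPlane :=
    (Complex.starConvex_one_slitPlane.isPathConnected
      Complex.one_mem_slitPlane).isConnected.isPreconnected
  have h2 : cutPlane = (fun w : ℂ => 1 - w) '' Complex.slitPlane := by
    ext z
    constructor
    · intro hz
      exact ⟨1 - z, hz, by simp⟩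
    · rintro ⟨w, hw, rfl⟩
      simpa [cutPlane] using hw
  rw [h2]
  exact h1.image _ (by fun_prop)

/-- The continuation is unique, so `gaussHypergeometric` does not depend on a choice. -/
lemma gaussHypergeometric_eq {a b c : ℂ} {F : ℂ → ℂ} (hF : IsGaussHypergeometric a b c F)
    {z : ℂ} (hz : z ∈ cutPlane) : gaussHypergeometric a b c z = F z := by
  have H : ∃ F : ℂ → ℂ, IsGaussHypergeometric a b c F := ⟨F, hF⟩
  have hG := H.choose_spec
  rw [gaussHypergeometric, dif_pos H]
  have h0 : (0 : ℂ) ∈ cutPlane := by simp [cutPlane]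
  refine (hG.1.analyticOnNhd isOpen_cutPlane).eqOn_of_preconnected_of_eventuallyEq
    (hF.1.analyticOnNhd isOpen_cutPlane) isPreconnected_cutPlane h0 ?_ hz
  filter_upwards [Metric.ball_mem_nhds (0 : ℂ) one_pos] with w hw
  rw [hG.2 w hw, hF.2 w hw]

/-- `η(s, m, r) = ₂F₁(m, -2/α; 1 - 2/α; -s / (m r ^ α))`. The parameters are real and the argument
is real and less than `1`, so the value is real. -/
def eta (α s m r : ℝ) : ℝ :=
  (gaussHypergeometric (m : ℂ) ((-(2 / α) : ℝ) : ℂ) ((1 - 2 / α : ℝ) : ℂ)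
    ((-(s / (m * r ^ α)) : ℝ) : ℂ)).re

/-- `ζ(m) = - Γ(m + 2/α) Γ(-2/α) / (α Γ(m))`. -/
def zeta (α m : ℝ) : ℝ :=
  -(Real.Gamma (m + 2 / α) * Real.Gamma (-(2 / α)) / (α * Real.Gamma m))

/-! ### Poisson point processes with Rayleigh fading -/

/-- The random measure `N` is (the counting measure of) a Poisson point process with intensity
measure `μ`: the number of points in a set of finite `μ`-measure is Poisson with mean the measure
of that set, and the numbers of points in disjoint sets are independent. -/
structure IsPoissonPointProcess {Ω E : Type*} [MeasurableSpace Ω] [MeasurableSpace E]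
    (P : Measure Ω) (μ : Measure E) (N : Ω → Measure E) : Prop where
  measurable : Measurable N
  law : ∀ A : Set E, MeasurableSet A → μ A ≠ ∞ →
    HasLaw (fun ω => N ω A) ((poissonMeasure (μ A).toNNReal).map (Nat.cast : ℕ → ℝ≥0∞)) P
  indep : ∀ (n : ℕ) (A : Fin n → Set E), (∀ i, MeasurableSet (A i)) →
    Pairwise (fun i j => Disjoint (A i) (A j)) → iIndepFun (fun i ω => N ω (A i)) P

/-- The Euclidean plane. -/
abbrev Plane : Type := EuclideanSpace ℝ (Fin 2)

/-- The base stations `x i` form a homogeneous Poisson point process of density `lam` in the plane,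
and their power fading gains `g i` are i.i.d. exponential of mean `1` (Rayleigh fading) and
independent of the locations. -/
structure IsRayleighNetwork {Ω : Type*} [MeasurableSpace Ω] (P : Measure Ω) (lam : ℝ)
    (x : ℕ → Ω → Plane) (g : ℕ → Ω → ℝ) : Prop where
  measurable_location : ∀ i, Measurable (x i)
  measurable_gain : ∀ i, Measurable (g i)
  poisson : IsPoissonPointProcess P (ENNReal.ofReal lam • (volume : Measure Plane))
    (fun ω => Measure.sum fun i => Measure.dirac (x i ω))
  gain_law : ∀ i, HasLaw (g i) (expMeasure 1) P
  gain_indep : iIndepFun g P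
  location_gain_indep : IndepFun (fun ω i => x i ω) (fun ω i => g i ω) P

/-- The pathloss at horizontal distance `t` for base stations of height `h`. -/
def pathloss (α h t : ℝ) : ℝ := (t ^ 2 + h ^ 2) ^ (-(α / 2))

/-- The base station association policy. -/
inductive Association
  | closest
  | strongest

/-- Given a serving base station at horizontal distance `r`, the interfering ones are distributed as
the points of the Poisson process at horizontal distance at least `ν(r)`, with `ν(r) = r` for
closest and `ν(r) = 0` for strongest association. -/
def nu : Association → ℝ → ℝ
  | .closest, r => r
  | .strongest, _ => 0

open Classical in
/-- The aggregate interference power at the origin when the serving base station is at horizontal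
distance `r`. -/
def interference {Ω : Type*} (x : ℕ → Ω → Plane) (g : ℕ → Ω → ℝ) (α h : ℝ) (q : Association)
    (r : ℝ) (ω : Ω) : ℝ≥0∞ :=
  ∑' i, if nu q r ≤ ‖x i ω‖ then ENNReal.ofReal (g i ω * pathloss α h ‖x i ω‖) else 0

open Classical in
/-- The Laplace transform `E[exp(-s X)]` of a random variable with values in `[0, ∞]`, with the
convention that `exp(-s X) = 0` where `X = ∞` (for every `s`, so that the value at `s = 0` is
the probability that `X` is finite). -/
def laplaceTransform {Ω : Type*} [MeasurableSpace Ω] (P : Measure Ω) (X : Ω → ℝ≥0∞) (s : ℝ) : ℝ :=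
  ∫ ω, (if X ω = ∞ then 0 else Real.exp (-s * (X ω).toReal)) ∂P

/-- The integral expression of the Laplace transform of the interference with Rayleigh fading. -/
def laplaceIntegral (lam α h : ℝ) (q : Association) (r s : ℝ) : ℝ :=
  Real.exp (-2 * Real.pi * lam *
    ∫ t in Set.Ioi (nu q r), (1 - 1 / (1 + s * pathloss α h t)) * t)

/-- The closed form of the Laplace transform of the interference with non-elevated base stations:
`exp(-πλr²(η(s,1,r) - 1))` for closest and `exp(-2πλζ(1)s^(2/α))` for strongest association. -/
def laplaceNonElevated (lam α : ℝ) : Association → ℝ → ℝ → ℝ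
  | .closest, r, s => Real.exp (-Real.pi * lam * r ^ 2 * (eta α s 1 r - 1))
  | .strongest, _, s => Real.exp (-2 * Real.pi * lam * zeta α 1 * s ^ (2 / α))

end ElevatedBS

end

noncomputable section

namespace ElevatedBS

open Filter Topology

/-! Probabilistic half. Given the locations, averaging over the gains turns `exp (-s I)` into `∏ 1 /
(1 + b (x i)) = exp (-∑ log (1 + b (x i)))`, where `b` is `s` times the pathloss, cut off below
`ν(r)`. The Laplace functional `E exp (-∫ f dN) = exp (-∫ (1 - exp (-f)) dμ)` of the Poisson
process, taken at `f = log (1 + b)`, then gives `exp (-λ ∫ (1 - 1 / (1 + b)))`, and polar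
coordinates make this `laplaceIntegral`. Working in `[0, ∞]` with `exp (-∞) = 0` removes all
convergence questions; finiteness of the interference comes out at the end, by letting `s → 0`.

Analytic half. The substitution `u ^ 2 = t ^ 2 + h ^ 2` (`integral_fading_elevated`) shows that
height only moves the lower limit of the non-elevated integral from `ν` to `√(ν ^ 2 + h ^ 2)`. The
correction factor is the piece between these limits. The closed forms come from `w = t ^ (-α)` with
`d = 2 / α` in `(0, 1)`: a positive lower limit yields, after scaling, an Euler integral over `(0,
1)`, which is `₂F₁` (`eta_one`); the limit `0` yields the beta integral `Γ(d) Γ(1 - d)`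
(`integral_rpow_neg_div_one_add`). -/

/-- The function `x ↦ exp (-x)` on `[0, ∞]`, with `exp (-∞) = 0`. -/
def expNeg (x : ℝ≥0∞) : ℝ≥0∞ := EReal.exp (-(x : EReal))

lemma continuous_expNeg : Continuous expNeg :=
  ENNReal.continuous_exp.comp (continuous_neg.comp continuous_coe_ennreal_ereal)

@[fun_prop]
lemma measurable_expNeg : Measurable expNeg := continuous_expNeg.measurable

@[simp] lemma expNeg_zero : expNeg 0 = 1 := by simp [expNeg]

@[simp] lemma expNeg_top : expNeg ∞ = 0 := by simp [expNeg]

lemma expNeg_ofReal {x : ℝ} (hx : 0 ≤ x) :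
    expNeg (ENNReal.ofReal x) = ENNReal.ofReal (Real.exp (-x)) := by
  rw [expNeg, EReal.coe_ennreal_ofReal, max_eq_left hx, ← EReal.coe_neg, EReal.exp_coe]

lemma expNeg_of_ne_top {x : ℝ≥0∞} (hx : x ≠ ∞) :
    expNeg x = ENNReal.ofReal (Real.exp (-x.toReal)) := by
  rw [← expNeg_ofReal ENNReal.toReal_nonneg, ENNReal.ofReal_toReal hx]

lemma expNeg_add (x y : ℝ≥0∞) : expNeg (x + y) = expNeg x * expNeg y := by
  rcases eq_or_ne x ∞ with rfl | hx
  · simp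
  rcases eq_or_ne y ∞ with rfl | hy
  · simp
  rw [expNeg_of_ne_top hx, expNeg_of_ne_top hy, expNeg_of_ne_top (by simp [hx, hy]),
    ENNReal.toReal_add hx hy, ← ENNReal.ofReal_mul (Real.exp_nonneg _), ← Real.exp_add, neg_add]

lemma expNeg_sum {ι : Type*} (t : Finset ι) (f : ι → ℝ≥0∞) :
    expNeg (∑ i ∈ t, f i) = ∏ i ∈ t, expNeg (f i) := by
  classical
  induction t using Finset.induction_on with
  | empty => simp
  | insert a t ha ih => rw [Finset.sum_insert ha, Finset.prod_insert ha, expNeg_add, ih]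

lemma expNeg_mul_natCast (x : ℝ≥0∞) (n : ℕ) : expNeg (x * n) = expNeg x ^ n := by
  induction n with
  | zero => simp
  | succ n ih => rw [Nat.cast_succ, mul_add, mul_one, expNeg_add, ih, pow_succ]

lemma expNeg_le_one (x : ℝ≥0∞) : expNeg x ≤ 1 := by
  simpa [expNeg] using EReal.coe_ennreal_nonneg x

/-- The Laplace transform of the Poisson distribution. -/
lemma lintegral_expNeg_mul_poissonMeasure (m : ℝ≥0) (c : ℝ≥0∞) :
    ∫⁻ n, expNeg (c * (n : ℕ)) ∂(poissonMeasure m) = expNeg ((1 - expNeg c) * m) := by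
  obtain ⟨q, hq⟩ : ∃ q : ℝ≥0, expNeg c = q :=
    ⟨_, (ENNReal.coe_toNNReal ((expNeg_le_one c).trans_lt ENNReal.one_lt_top).ne).symm⟩
  have hq1 : q ≤ 1 := by exact_mod_cast hq ▸ expNeg_le_one c
  have hq2 : (q : ℝ) ≤ 1 := hq1
  simp_rw [expNeg_mul_natCast, hq]
  rw [lintegral_countable']
  simp_rw [poissonMeasure_singleton]
  have hterm : ∀ n : ℕ, (q : ℝ≥0∞) ^ n * ENNReal.ofReal (Real.exp (-m) * m ^ n / n.factorial)
      = ENNReal.ofReal (Real.exp (-m) * ((q * m : ℝ) ^ n / n.factorial)) := by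
    intro n
    rw [← ENNReal.ofReal_coe_nnreal, ← ENNReal.ofReal_pow q.coe_nonneg,
      ← ENNReal.ofReal_mul (by positivity)]
    congr 1
    rw [mul_pow]; ring
  have hs : HasSum (fun n : ℕ => Real.exp (-m) * ((q * m : ℝ) ^ n / n.factorial))
      (Real.exp (-m) * Real.exp (q * m)) := by
    have := NormedSpace.expSeries_div_hasSum_exp (𝔸 := ℝ) (q * m : ℝ)
    rw [← Real.exp_eq_exp_ℝ] at this
    exact this.mul_left _
  simp_rw [hterm]
  rw [← ENNReal.ofReal_tsum_of_nonneg (fun n => by positivity) hs.summable, hs.tsum_eq,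
    ← Real.exp_add]
  have h1 : (1 - (q : ℝ≥0∞)) * m = ENNReal.ofReal ((1 - q) * m) := by
    rw [ENNReal.ofReal_mul (by linarith), ENNReal.ofReal_sub _ q.coe_nonneg]
    simp
  rw [h1, expNeg_ofReal (mul_nonneg (by linarith) m.coe_nonneg)]
  congr 2; ring

/-! ### Laplace functional of a Poisson point process. -/

namespace IsPoissonPointProcess

variable {Ω E : Type*} [MeasurableSpace Ω] [MeasurableSpace E] {P : Measure Ω} {μ : Measure E}
  {N : Ω → Measure E}

lemma lintegral_expNeg_mul_apply (hN : IsPoissonPointProcess P μ N) {A : Set E}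
    (hA : MeasurableSet A) (hμ : μ A ≠ ∞) (c : ℝ≥0∞) :
    ∫⁻ ω, expNeg (c * N ω A) ∂P = expNeg ((1 - expNeg c) * μ A) := by
  rw [(hN.law A hA hμ).lintegral_comp (f := fun y => expNeg (c * y)) (by fun_prop),
    lintegral_map (by fun_prop) (by fun_prop), lintegral_expNeg_mul_poissonMeasure,
    ENNReal.coe_toNNReal hμ]

/-- The Laplace functional of a Poisson point process at a simple function. -/
lemma lintegral_expNeg_lintegral_simpleFunc [IsProbabilityMeasure P]
    (hN : IsPoissonPointProcess P μ N)
    (f : SimpleFunc E ℝ≥0∞) (hf : ∀ c ≠ 0, μ (f ⁻¹' {c}) ≠ ∞) :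
    ∫⁻ ω, expNeg (∫⁻ y, f y ∂N ω) ∂P = expNeg (∫⁻ y, (1 - expNeg (f y)) ∂μ) := by
  -- Independence is available for families indexed by `Fin n`, so the values of `f`, hence its
  -- disjoint fibres, are enumerated.
  let e := f.range.equivFin
  have hind := hN.indep f.range.card (fun i => f ⁻¹' {(e.symm i : ℝ≥0∞)})
    (fun i => f.measurableSet_fiber _) (fun i j hij => by
      refine Disjoint.preimage _ (Set.disjoint_singleton.2 fun h => hij ?_)
      exact e.symm.injective (Subtype.ext h))
  have hmeas : ∀ A, MeasurableSet A → Measurable fun ω => N ω A := fun A hA =>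
    (Measure.measurable_coe hA).comp hN.measurable
  have hind' := hind.comp (fun i y => expNeg ((e.symm i : ℝ≥0∞) * y)) (fun i => by fun_prop)
  have hprod := lintegral_prod_eq_prod_lintegral_of_indepFun Finset.univ _ hind'
    (fun i => (measurable_expNeg.comp (measurable_const_mul _)).comp
      (hmeas _ (f.measurableSet_fiber _)))
  have hre : ∀ F : ℝ≥0∞ → ℝ≥0∞, ∏ i, F (e.symm i) = ∏ c ∈ f.range, F c := fun F => by
    rw [e.symm.prod_comp (fun c : f.range => F c), Finset.prod_coe_sort f.range F]
  have hL : ∀ ω, expNeg (∫⁻ y, f y ∂N ω)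
      = ∏ i, expNeg ((e.symm i : ℝ≥0∞) * N ω (f ⁻¹' {(e.symm i : ℝ≥0∞)})) := fun ω => by
    rw [hre (fun c => expNeg (c * N ω (f ⁻¹' {c}))), ← expNeg_sum, SimpleFunc.lintegral_eq_lintegral]
    rfl
  simp_rw [hL]
  simp only [Function.comp_def] at hprod
  rw [hprod, hre (fun c => ∫⁻ ω, expNeg (c * N ω (f ⁻¹' {c})) ∂P)]
  have hR : ∫⁻ y, (1 - expNeg (f y)) ∂μ = ∑ c ∈ f.range, (1 - expNeg c) * μ (f ⁻¹' {c}) := by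
    rw [← SimpleFunc.map_lintegral (fun c => 1 - expNeg c) f, ← SimpleFunc.lintegral_eq_lintegral]
    rfl
  rw [hR, expNeg_sum]
  refine Finset.prod_congr rfl fun c _ => ?_
  -- The fibre over `0` may have infinite measure, but both factors are then `1`.
  rcases eq_or_ne c 0 with rfl | hc
  · simp
  · exact hN.lintegral_expNeg_mul_apply (f.measurableSet_fiber _) (hf c hc) c

/-- The Laplace functional of a Poisson point process. -/
theorem lintegral_expNeg_lintegral [IsProbabilityMeasure P] [SigmaFinite μ]
    (hN : IsPoissonPointProcess P μ N) {f : E → ℝ≥0∞} (hf : Measurable f) :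
    ∫⁻ ω, expNeg (∫⁻ y, f y ∂N ω) ∂P = expNeg (∫⁻ y, (1 - expNeg (f y)) ∂μ) := by
  -- Restricting to spanning sets makes the fibres over nonzero values of finite measure, while `F
  -- n` still increases to `f`.
  let F : ℕ → SimpleFunc E ℝ≥0∞ := fun n =>
    (SimpleFunc.eapprox f n).restrict (spanningSets μ n)
  have hF : ∀ n y, F n y = (spanningSets μ n).indicator (SimpleFunc.eapprox f n) y := fun n y =>
    SimpleFunc.restrict_apply _ (measurableSet_spanningSets μ n) y
  have hmono : ∀ y, Monotone fun n => F n y := fun y m n hmn => by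
    simp only [hF]
    exact (Set.indicator_le_indicator_of_subset (monotone_spanningSets μ hmn)
      (fun _ => zero_le) y).trans
        (Set.indicator_le_indicator (SimpleFunc.monotone_eapprox f hmn y))
  have hlim : ∀ y, Tendsto (fun n => F n y) atTop (𝓝 (f y)) := fun y => by
    have h1 : Tendsto (fun n => SimpleFunc.eapprox f n y) atTop (𝓝 (f y)) := by
      rw [← SimpleFunc.iSup_eapprox_apply hf y]
      exact tendsto_atTop_iSup fun m n hmn => SimpleFunc.monotone_eapprox f hmn y
    refine h1.congr' ?_
    filter_upwards [eventually_ge_atTop (spanningSetsIndex μ y)] with n hn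
    rw [hF, Set.indicator_of_mem
      (monotone_spanningSets μ hn (mem_spanningSetsIndex μ y))]
  have hsimple : ∀ n, ∫⁻ ω, expNeg (∫⁻ y, F n y ∂N ω) ∂P
      = expNeg (∫⁻ y, (1 - expNeg (F n y)) ∂μ) := fun n => by
    refine hN.lintegral_expNeg_lintegral_simpleFunc (F n) fun c hc => ?_
    refine ((measure_mono fun y hy => ?_).trans_lt (measure_spanningSets_lt_top μ n)).ne
    by_contra hy'
    exact hc (by rw [← (show F n y = c from hy), hF, Set.indicator_of_notMem hy'])
  have hleft : Tendsto (fun n => ∫⁻ ω, expNeg (∫⁻ y, F n y ∂N ω) ∂P) atTop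
      (𝓝 (∫⁻ ω, expNeg (∫⁻ y, f y ∂N ω) ∂P)) := by
    refine tendsto_lintegral_of_dominated_convergence 1 (fun n => ?_)
      (fun n => .of_forall fun ω => expNeg_le_one _) (by simp) (.of_forall fun ω => ?_)
    · exact measurable_expNeg.comp
        ((Measure.measurable_lintegral (F n).measurable).comp hN.measurable)
    · exact (continuous_expNeg.tendsto _).comp (lintegral_tendsto_of_tendsto_of_monotone
        (fun n => (F n).aemeasurable) (.of_forall hmono) (.of_forall hlim))
  have hsub : Continuous fun x => 1 - expNeg x :=
    (ENNReal.continuous_sub_left ENNReal.one_ne_top).comp continuous_expNeg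
  have hanti : Antitone expNeg := fun x y hxy => by
    rw [expNeg, expNeg, EReal.exp_le_exp_iff, EReal.neg_le_neg_iff]
    exact_mod_cast hxy
  have hright : Tendsto (fun n => expNeg (∫⁻ y, (1 - expNeg (F n y)) ∂μ)) atTop
      (𝓝 (expNeg (∫⁻ y, (1 - expNeg (f y)) ∂μ))) := by
    refine (continuous_expNeg.tendsto _).comp (lintegral_tendsto_of_tendsto_of_monotone
      (fun n => (hsub.measurable.comp (F n).measurable).aemeasurable)
      (.of_forall fun y m n hmn => ?_) (.of_forall fun y => ?_))
    · exact tsub_le_tsub_left (hanti (hmono y hmn)) _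
    · exact (hsub.tendsto _).comp (hlim y)
  simp_rw [hsimple] at hleft
  exact tendsto_nhds_unique hleft hright

end IsPoissonPointProcess

/-! ### Exponential gains and the marked process. -/

/-- The Laplace transform of the exponential distribution of mean `1`. -/
lemma lintegral_expNeg_mul_expMeasure {b : ℝ} (hb : 0 ≤ b) :
    ∫⁻ y, expNeg (ENNReal.ofReal (y * b)) ∂(expMeasure 1) = ENNReal.ofReal (1 / (1 + b)) := by
  -- Exponential tilting: the rate-`1` density times `exp (-b y)` is a multiple of the rate-`(1 +
  -- b)` density, whose total mass is `1`.
  have hpdf : ∀ y, exponentialPDF 1 y * expNeg (ENNReal.ofReal (y * b))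
      = ENNReal.ofReal (1 / (1 + b)) * exponentialPDF (1 + b) y := fun y => by
    rcases lt_or_ge y 0 with hy | hy
    · simp [exponentialPDF_of_neg hy]
    · rw [exponentialPDF_of_nonneg hy, exponentialPDF_of_nonneg hy,
        expNeg_ofReal (mul_nonneg hy hb), ← ENNReal.ofReal_mul (by positivity),
        ← ENNReal.ofReal_mul (by positivity), mul_assoc, ← Real.exp_add, ← mul_assoc,
        one_div_mul_cancel (by positivity)]
      congr 3; ring
  have hmeas : ∀ r, Measurable (exponentialPDF r) := fun r =>
    (measurable_exponentialPDFReal r).ennreal_ofReal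
  have hexp : expMeasure 1 = volume.withDensity (exponentialPDF 1) := rfl
  rw [hexp, lintegral_withDensity_eq_lintegral_mul _ (hmeas 1) (by fun_prop)]
  simp only [Pi.mul_apply, hpdf]
  rw [lintegral_const_mul _ (hmeas _), lintegral_exponentialPDF_eq_one (by positivity), mul_one]

/-- The Laplace transform of a series of independent exponential random variables. -/
lemma lintegral_expNeg_tsum_of_exponential {Ω : Type*} [MeasurableSpace Ω] {P : Measure Ω}
    {g : ℕ → Ω → ℝ} (hmeas : ∀ i, Measurable (g i)) (hlaw : ∀ i, HasLaw (g i) (expMeasure 1) P)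
    (hind : iIndepFun g P) {b : ℕ → ℝ} (hb : ∀ i, 0 ≤ b i) :
    ∫⁻ ω, expNeg (∑' i, ENNReal.ofReal (g i ω * b i)) ∂P
      = expNeg (∑' i, ENNReal.ofReal (Real.log (1 + b i))) := by
  have : IsProbabilityMeasure P := hind.isProbabilityMeasure
  have hfin : ∀ n, ∫⁻ ω, expNeg (∑ i ∈ Finset.range n, ENNReal.ofReal (g i ω * b i)) ∂P
      = expNeg (∑ i ∈ Finset.range n, ENNReal.ofReal (Real.log (1 + b i))) := fun n => by
    simp_rw [expNeg_sum]
    rw [lintegral_prod_eq_prod_lintegral_of_indepFun _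
      (fun i ω => expNeg (ENNReal.ofReal (g i ω * b i)))
      (hind.comp (fun i y => expNeg (ENNReal.ofReal (y * b i))) (fun i => by fun_prop))
      (fun i => by have := hmeas i; fun_prop)]
    refine Finset.prod_congr rfl fun i _ => ?_
    rw [(hlaw i).lintegral_comp (f := fun y => expNeg (ENNReal.ofReal (y * b i))) (by fun_prop),
      lintegral_expNeg_mul_expMeasure (hb i),
      expNeg_ofReal (Real.log_nonneg (by linarith [hb i])), Real.exp_neg,
      Real.exp_log (by linarith [hb i]), one_div]
  have hleft : Tendsto (fun n => ∫⁻ ω, expNeg (∑ i ∈ Finset.range n,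
      ENNReal.ofReal (g i ω * b i)) ∂P) atTop
      (𝓝 (∫⁻ ω, expNeg (∑' i, ENNReal.ofReal (g i ω * b i)) ∂P)) := by
    refine tendsto_lintegral_of_dominated_convergence 1 (fun n => ?_)
      (fun n => .of_forall fun ω => expNeg_le_one _) (by simp) (.of_forall fun ω => ?_)
    · fun_prop
    · exact (continuous_expNeg.tendsto _).comp (ENNReal.tendsto_nat_tsum _)
  simp_rw [hfin] at hleft
  exact tendsto_nhds_unique hleft
    ((continuous_expNeg.tendsto _).comp (ENNReal.tendsto_nat_tsum _))

lemma pathloss_nonneg (α h t : ℝ) : 0 ≤ pathloss α h t :=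
  Real.rpow_nonneg (by positivity) _

namespace IsRayleighNetwork

variable {Ω : Type*} [MeasurableSpace Ω] {P : Measure Ω} {lam : ℝ}
  {x : ℕ → Ω → Plane} {g : ℕ → Ω → ℝ}

/-- The Laplace functional of a Poisson point process marked with independent exponential gains. -/
lemma lintegral_expNeg_tsum [IsProbabilityMeasure P] (hnet : IsRayleighNetwork P lam x g) {b : Plane → ℝ}
    (hbm : Measurable b) (hb : ∀ y, 0 ≤ b y) :
    ∫⁻ ω, expNeg (∑' i, ENNReal.ofReal (g i ω * b (x i ω))) ∂P
      = expNeg (ENNReal.ofReal lam * ∫⁻ y, ENNReal.ofReal (1 - 1 / (1 + b y))) := by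
  have hx : Measurable fun ω i => x i ω := measurable_pi_lambda _ hnet.measurable_location
  have hg : Measurable fun ω i => g i ω := measurable_pi_lambda _ hnet.measurable_gain
  let Φ : (ℕ → Plane) × (ℕ → ℝ) → ℝ≥0∞ := fun p =>
    expNeg (∑' i, ENNReal.ofReal (p.2 i * b (p.1 i)))
  have hΦ : Measurable Φ := by
    refine measurable_expNeg.comp (Measurable.tsum fun i => ?_)
    exact (((measurable_pi_apply i).comp measurable_snd).mul
      (hbm.comp ((measurable_pi_apply i).comp measurable_fst))).ennreal_ofReal
  -- Independence makes the joint law a product, so the gains can be averaged with the locations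
  -- frozen.
  have hjoint : ∫⁻ ω, Φ (fun i => x i ω, fun i => g i ω) ∂P
      = ∫⁻ ω, ∫⁻ ω', Φ (fun i => x i ω, fun i => g i ω') ∂P ∂P := by
    rw [← lintegral_map (g := fun ω => ((fun i => x i ω, fun i => g i ω) :
        (ℕ → Plane) × (ℕ → ℝ))) hΦ (hx.prodMk hg),
      (indepFun_iff_map_prod_eq_prod_map_map hx.aemeasurable hg.aemeasurable).1
        hnet.location_gain_indep]
    have : IsProbabilityMeasure (P.map fun ω i => g i ω) :=
      Measure.isProbabilityMeasure_map hg.aemeasurable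
    rw [lintegral_prod _ hΦ.aemeasurable, lintegral_map hΦ.lintegral_prod_right' hx]
    refine lintegral_congr fun ω => ?_
    exact lintegral_map (hΦ.comp measurable_prodMk_left) hg
  let f : Plane → ℝ≥0∞ := fun y => ENNReal.ofReal (Real.log (1 + b y))
  have hf : Measurable f := by fun_prop
  have hinner : ∀ ω, ∫⁻ ω', Φ (fun i => x i ω, fun i => g i ω') ∂P
      = expNeg (∫⁻ y, f y ∂(Measure.sum fun i => Measure.dirac (x i ω))) := fun ω => by
    rw [lintegral_sum_measure]
    simp_rw [lintegral_dirac' _ hf]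
    exact lintegral_expNeg_tsum_of_exponential hnet.measurable_gain hnet.gain_law
      hnet.gain_indep fun i => hb (x i ω)
  have : SigmaFinite (ENNReal.ofReal lam • (volume : Measure Plane)) :=
    inferInstanceAs (SigmaFinite (lam.toNNReal • (volume : Measure Plane)))
  have hL : ∀ y, 1 - expNeg (f y) = ENNReal.ofReal (1 - 1 / (1 + b y)) := fun y => by
    have := hb y
    rw [expNeg_ofReal (Real.log_nonneg (by linarith)), Real.exp_neg, Real.exp_log (by linarith),
      ENNReal.ofReal_sub _ (by positivity), one_div, ENNReal.ofReal_one]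
  change ∫⁻ ω, Φ (fun i => x i ω, fun i => g i ω) ∂P = _
  rw [hjoint]
  simp_rw [hinner]
  rw [hnet.poisson.lintegral_expNeg_lintegral hf, lintegral_smul_measure]
  simp_rw [hL, smul_eq_mul]

lemma measurable_interference (hnet : IsRayleighNetwork P lam x g) (α h : ℝ) (q : Association)
    (r : ℝ) : Measurable (interference x g α h q r) := by
  classical
  refine Measurable.tsum fun i => ?_
  have hx := hnet.measurable_location i
  have hg := hnet.measurable_gain i
  refine Measurable.ite (measurableSet_le measurable_const hx.norm) ?_ measurable_const
  unfold pathloss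
  fun_prop

/-- The integral expression of the Laplace transform of the interference. -/
lemma laplaceTransform_interference [IsProbabilityMeasure P] (hnet : IsRayleighNetwork P lam x g)
    (hlam : 0 < lam) {α h : ℝ} {q : Association} {r s : ℝ} (hr : 0 ≤ nu q r) (hs : 0 < s)
    (hint : IntegrableOn (fun t => (1 - 1 / (1 + s * pathloss α h t)) * t) (Set.Ioi (nu q r))) :
    laplaceTransform P (interference x g α h q r) s = laplaceIntegral lam α h q r s := by
  classical
  have hm := hnet.measurable_interference α h q r
  -- Excluded stations get weight `0`, so the sum runs over the whole process.
  let b : Plane → ℝ := fun y => if nu q r ≤ ‖y‖ then s * pathloss α h ‖y‖ else 0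
  have hbm : Measurable b := by
    refine Measurable.ite (measurableSet_le measurable_const measurable_norm) ?_ measurable_const
    unfold pathloss
    fun_prop
  have hb : ∀ y, 0 ≤ b y := fun y => by
    have := pathloss_nonneg α h ‖y‖
    simp only [b]; split_ifs <;> positivity
  have hI : ∀ ω, ENNReal.ofReal s * interference x g α h q r ω
      = ∑' i, ENNReal.ofReal (g i ω * b (x i ω)) := fun ω => by
    rw [interference, ← ENNReal.tsum_mul_left]
    refine tsum_congr fun i => ?_
    simp only [b]
    split_ifs
    · rw [← ENNReal.ofReal_mul hs.le]; congr 1; ring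
    · simp
  have hkey : laplaceTransform P (interference x g α h q r) s
      = (∫⁻ ω, expNeg (ENNReal.ofReal s * interference x g α h q r ω) ∂P).toReal := by
    rw [← integral_toReal (by fun_prop)
      (.of_forall fun ω => (expNeg_le_one _).trans_lt ENNReal.one_lt_top)]
    refine integral_congr_ae (.of_forall fun ω => ?_)
    dsimp only
    split_ifs with hω
    -- Here `s > 0` matters: `s * ∞ = ∞` and `exp (-∞) = 0`, as in the convention of
    -- `laplaceTransform`.
    · simp [hω, ENNReal.mul_top, hs]
    · rw [expNeg_of_ne_top (ENNReal.mul_ne_top ENNReal.ofReal_ne_top hω), ENNReal.toReal_mul,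
        ENNReal.toReal_ofReal hs.le, ENNReal.toReal_ofReal (Real.exp_nonneg _), neg_mul]
  let F : ℝ → ℝ := fun t => if nu q r ≤ t then 1 - 1 / (1 + s * pathloss α h t) else 0
  have hbF : ∀ y, 1 - 1 / (1 + b y) = F ‖y‖ := fun y => by
    simp only [b, F]; split_ifs <;> simp
  have hF0 : ∀ t, 0 ≤ F t := fun t => by
    simp only [F]
    split_ifs
    · have := mul_nonneg hs.le (pathloss_nonneg α h t)
      rw [sub_nonneg, div_le_one (by positivity)]; linarith
    · exact le_rfl
  have hdim : Module.finrank ℝ Plane = 2 := by simp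
  have hind : (fun t => t * F t) =
      (Set.Ici (nu q r)).indicator fun t => (1 - 1 / (1 + s * pathloss α h t)) * t := by
    ext t
    by_cases ht : nu q r ≤ t
    · simp [F, ht, mul_comm]
    · simp [F, ht]
  have hFint : Integrable (fun y : Plane => F ‖y‖) := by
    rw [integrable_fun_norm_addHaar (volume : Measure Plane) (f := F), hdim]
    simp only [Nat.add_one_sub_one, pow_one, smul_eq_mul, hind]
    refine ((integrable_indicator_iff measurableSet_Ici).2 ?_).integrableOn
    rwa [integrableOn_Ici_iff_integrableOn_Ioi]
  have hFval : ∫ y : Plane, F ‖y‖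
      = 2 * Real.pi * ∫ t in Set.Ioi (nu q r), (1 - 1 / (1 + s * pathloss α h t)) * t := by
    rw [integral_fun_norm_addHaar (volume : Measure Plane) F, hdim]
    simp only [Nat.add_one_sub_one, pow_one, smul_eq_mul, hind, nsmul_eq_mul, Nat.cast_ofNat]
    have hvol : (volume : Measure Plane).real (Metric.ball 0 1) = Real.pi := by
      simp [measureReal_def, Real.pi_nonneg]
    have hset : (Set.Ioi 0 ∩ Set.Ici (nu q r) : Set ℝ) =ᵐ[volume] Set.Ioi (nu q r) := by
      rcases hr.eq_or_lt with h0 | h0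
      · rw [← h0, Set.inter_eq_left.2 Set.Ioi_subset_Ici_self]
        exact EventuallyEq.rfl
      · rw [Set.inter_eq_right.2 (Set.Ici_subset_Ioi.2 h0)]
        exact Ioi_ae_eq_Ici.symm
    rw [hvol, setIntegral_indicator measurableSet_Ici, setIntegral_congr_set hset]
    ring
  rw [hkey]
  simp_rw [hI]
  rw [hnet.lintegral_expNeg_tsum hbm hb]
  simp_rw [hbF]
  rw [← ofReal_integral_eq_lintegral_ofReal hFint (.of_forall fun y => hF0 _),
    ← ENNReal.ofReal_mul hlam.le,
    expNeg_ofReal (mul_nonneg hlam.le (integral_nonneg fun y => hF0 _)),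
    ENNReal.toReal_ofReal (Real.exp_nonneg _), hFval, laplaceIntegral]
  congr 1; ring

end IsRayleighNetwork

/-! ### An Euler integral for `₂F₁(1, -d; 1 - d; ·)` -/

lemma integrableOn_rpow_neg {d : ℝ} (hd1 : d < 1) :
    IntegrableOn (fun w : ℝ => w ^ (-d)) (Set.Ioo 0 1) := by
  have h := intervalIntegral.intervalIntegrable_rpow' (a := 0) (b := 1) (r := -d) (by linarith)
  rw [intervalIntegrable_iff_integrableOn_Ioc_of_le zero_le_one] at h
  exact h.mono_set Set.Ioo_subset_Ioc_self

/-- The point `1 - z w` lies on the segment from `1` to `1 - z`, and the slit plane is star-shaped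
about `1`. -/
lemma one_sub_mul_ne_zero {z : ℂ} (hz : z ∈ cutPlane) {w : ℝ} (hw : w ∈ Set.Icc (0 : ℝ) 1) :
    1 - z * w ≠ 0 := by
  have h : 1 - z * w ∈ Complex.slitPlane := by
    have := Complex.starConvex_one_slitPlane (show 1 - z ∈ Complex.slitPlane from hz)
      (sub_nonneg.2 hw.2) hw.1 (sub_add_cancel 1 w)
    convert this using 1
    simp only [Complex.real_smul]
    push_cast
    ring
  exact Complex.slitPlane_ne_zero h

/-- The function `z ↦ ∫₀¹ w ^ (-d) / (1 - z w) dw`. -/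
def stieltjes (d : ℝ) (z : ℂ) : ℂ :=
  ∫ w in Set.Ioo (0 : ℝ) 1, ((w ^ (-d) : ℝ) : ℂ) * (1 - z * w)⁻¹

/-- Differentiation under the integral sign. By compactness the denominator at `z₀` has a minimum
modulus `c > 0` over `[0, 1]`, hence modulus at least `c / 2` on the ball of radius `c / 2`; this
leaves a constant multiple of `w ^ (-d)` as dominating function. -/
lemma differentiableOn_stieltjes {d : ℝ} (hd1 : d < 1) :
    DifferentiableOn ℂ (stieltjes d) cutPlane := by
  intro z₀ hz₀
  obtain ⟨w₀, hw₀, hmin⟩ := isCompact_Icc.exists_isMinOn (s := Set.Icc (0 : ℝ) 1)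
    ⟨0, by simp⟩ (f := fun w : ℝ => ‖1 - z₀ * w‖) (by fun_prop)
  set c := ‖1 - z₀ * w₀‖ with hc
  have hc0 : 0 < c := norm_pos_iff.2 (one_sub_mul_ne_zero hz₀ hw₀)
  have hlow : ∀ w ∈ Set.Ioo (0 : ℝ) 1, ∀ z ∈ Metric.ball z₀ (c / 2), c / 2 ≤ ‖1 - z * w‖ := by
    intro w hw z hz
    have h1 : c ≤ ‖1 - z₀ * w‖ := hmin (Set.Ioo_subset_Icc_self hw)
    have h2 : ‖(z - z₀) * w‖ ≤ c / 2 := by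
      rw [norm_mul, Complex.norm_real, Real.norm_of_nonneg hw.1.le, ← dist_eq_norm]
      exact (mul_le_of_le_one_right dist_nonneg hw.2.le).trans hz.le
    have h3 : 1 - z₀ * w = (1 - z * w) + (z - z₀) * w := by ring
    have h4 := norm_add_le (1 - z * w) ((z - z₀) * w)
    rw [← h3] at h4
    linarith
  have hmeas : ∀ z : ℂ, AEStronglyMeasurable
      (fun w : ℝ => ((w ^ (-d) : ℝ) : ℂ) * (1 - z * w)⁻¹) (volume.restrict (Set.Ioo 0 1)) :=
    fun z => Measurable.aestronglyMeasurable (by fun_prop)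
  have hw_norm : ∀ w ∈ Set.Ioo (0 : ℝ) 1, ‖((w ^ (-d) : ℝ) : ℂ)‖ = w ^ (-d) := fun w hw => by
    rw [Complex.norm_real, Real.norm_of_nonneg (Real.rpow_nonneg hw.1.le _)]
  have hder := hasDerivAt_integral_of_dominated_loc_of_deriv_le (𝕜 := ℂ) (E := ℂ)
    (μ := volume.restrict (Set.Ioo (0 : ℝ) 1)) (s := Metric.ball z₀ (c / 2))
    (bound := fun w => w ^ (-d) * ((c / 2) ^ 2)⁻¹) (x₀ := z₀)
    (F := fun (z : ℂ) (w : ℝ) => ((w ^ (-d) : ℝ) : ℂ) * (1 - z * w)⁻¹)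
    (F' := fun (z : ℂ) (w : ℝ) => ((w ^ (-d) : ℝ) : ℂ) * (w * ((1 - z * w) ^ 2)⁻¹))
    (Metric.ball_mem_nhds _ (by positivity)) (.of_forall hmeas) ?_
    (Measurable.aestronglyMeasurable (by fun_prop)) ?_ ((integrableOn_rpow_neg hd1).mul_const _) ?_
  · exact hder.2.differentiableAt.differentiableWithinAt
  · refine Integrable.mono' ((integrableOn_rpow_neg hd1).mul_const (c / 2)⁻¹) (hmeas z₀) ?_
    filter_upwards [ae_restrict_mem measurableSet_Ioo] with w hw
    rw [norm_mul, hw_norm w hw, norm_inv]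
    gcongr
    · exact Real.rpow_nonneg hw.1.le _
    · exact hlow w hw z₀ (Metric.mem_ball_self (by positivity))
  · filter_upwards [ae_restrict_mem measurableSet_Ioo] with w hw z hz
    rw [norm_mul, hw_norm w hw, norm_mul, norm_inv, norm_pow, Complex.norm_real,
      Real.norm_of_nonneg hw.1.le]
    have h1 : (‖1 - z * w‖ ^ 2)⁻¹ ≤ ((c / 2) ^ 2)⁻¹ := by
      gcongr
      exact hlow w hw z hz
    have h2 : w * (‖1 - z * w‖ ^ 2)⁻¹ ≤ (‖1 - z * w‖ ^ 2)⁻¹ :=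
      mul_le_of_le_one_left (by positivity) hw.2.le
    exact mul_le_mul_of_nonneg_left (h2.trans h1) (Real.rpow_nonneg hw.1.le _)
  · filter_upwards [ae_restrict_mem measurableSet_Ioo] with w hw z hz
    have hne : 1 - z * w ≠ 0 := norm_pos_iff.1 (lt_of_lt_of_le (by positivity) (hlow w hw z hz))
    have h1 : HasDerivAt (fun z : ℂ => 1 - z * w) (-(w : ℂ)) z := by
      simpa using ((hasDerivAt_id z).mul_const (w : ℂ)).const_sub 1
    refine ((h1.inv hne).const_mul _).congr_deriv ?_
    rw [neg_neg, div_eq_mul_inv]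

/-- Expand `1 / (1 - z w)` as a geometric series and integrate termwise, with the `n`-th term
dominated by `w ^ (-d) * ‖z‖ ^ n`. -/
lemma hasSum_stieltjes {d : ℝ} (hd1 : d < 1) {z : ℂ} (hz : ‖z‖ < 1) :
    HasSum (fun n : ℕ => z ^ n / (n + 1 - d)) (stieltjes d z) := by
  have hint : ∀ n : ℕ, ∫ w in Set.Ioo (0 : ℝ) 1, ((w ^ (-d) : ℝ) : ℂ) * (z * w) ^ n
      = z ^ n / (n + 1 - d) := fun n => by
    have h1 : ∫ w in Set.Ioo (0 : ℝ) 1, w ^ (-d) * w ^ n = 1 / (n + 1 - d) := by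
      have h2 : ∫ w in (0 : ℝ)..1, w ^ (n - d) = 1 / (n + 1 - d) := by
        have hn : (0 : ℝ) ≤ n := n.cast_nonneg
        rw [integral_rpow (Or.inl (by linarith)), Real.one_rpow, Real.zero_rpow (by linarith),
          sub_zero]
        congr 1; ring
      rw [← h2, intervalIntegral.integral_of_le zero_le_one, integral_Ioc_eq_integral_Ioo]
      refine setIntegral_congr_fun measurableSet_Ioo fun w hw => ?_
      rw [← Real.rpow_natCast, ← Real.rpow_add hw.1]
      congr 1; ring
    have h3 : ∀ w : ℝ, ((w ^ (-d) : ℝ) : ℂ) * (z * w) ^ n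
        = z ^ n * ((w ^ (-d) * w ^ n : ℝ) : ℂ) := fun w => by
      push_cast; ring
    simp_rw [h3]
    rw [integral_const_mul, integral_complex_ofReal, h1]
    push_cast; ring
  simp_rw [← hint]
  have hw_norm : ∀ w ∈ Set.Ioo (0 : ℝ) 1, ‖((w ^ (-d) : ℝ) : ℂ)‖ = w ^ (-d) := fun w hw => by
    rw [Complex.norm_real, Real.norm_of_nonneg (Real.rpow_nonneg hw.1.le _)]
  have hzw : ∀ w ∈ Set.Ioo (0 : ℝ) 1, ‖z * w‖ ≤ ‖z‖ := fun w hw => by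
    rw [norm_mul, Complex.norm_real, Real.norm_of_nonneg hw.1.le]
    exact mul_le_of_le_one_right (norm_nonneg _) hw.2.le
  refine hasSum_integral_of_dominated_convergence (fun n w => w ^ (-d) * ‖z‖ ^ n)
    (fun n => Measurable.aestronglyMeasurable (by fun_prop)) (fun n => ?_)
    (.of_forall fun w => (summable_geometric_of_lt_one (norm_nonneg _) hz).mul_left _) ?_ ?_
  · filter_upwards [ae_restrict_mem measurableSet_Ioo] with w hw
    rw [norm_mul, hw_norm w hw, norm_pow]
    exact mul_le_mul_of_nonneg_left (pow_le_pow_left₀ (norm_nonneg _) (hzw w hw) n)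
      (Real.rpow_nonneg hw.1.le _)
  · simp_rw [tsum_mul_left]
    exact (integrableOn_rpow_neg hd1).mul_const _
  · filter_upwards [ae_restrict_mem measurableSet_Ioo] with w hw
    exact (hasSum_geometric_of_norm_lt_one ((hzw w hw).trans_lt hz)).mul_left _

/-- Both sides are the rising factorial of length `n + 1`, with its last or its first factor split
off. -/
lemma ascPochhammer_eval_mul_add {R : Type*} [CommRing R] (b : R) (n : ℕ) :
    (ascPochhammer R n).eval b * (b + n) = b * (ascPochhammer R n).eval (b + 1) := by
  rw [← ascPochhammer_succ_eval, ascPochhammer_succ_left]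
  simp

/-- The rising factorial of `1` cancels `n!`, and the other two telescope to the coefficient `-d /
(n - d)`. The term `n = 0` is `1`; the shifted rest is the series of `stieltjes`. -/
lemma ordinaryHypergeometric_one_neg {d : ℝ} (hd0 : 0 < d) (hd1 : d < 1) {z : ℂ}
    (hz : ‖z‖ < 1) :
    ₂F₁ (1 : ℂ) ((-d : ℝ) : ℂ) ((1 - d : ℝ) : ℂ) z = 1 - d * z * stieltjes d z := by
  have hne : ∀ n : ℕ, (n : ℂ) - d ≠ 0 := fun n h => by
    have h' : (n : ℝ) = d := by exact_mod_cast sub_eq_zero.1 h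
    rcases n.eq_zero_or_pos with rfl | hn
    · simp at h'; linarith
    · have : (1 : ℝ) ≤ n := by exact_mod_cast hn
      linarith
  have hcoef : ∀ n : ℕ, ((n.factorial : ℂ)⁻¹ * (ascPochhammer ℂ n).eval 1 *
      (ascPochhammer ℂ n).eval ((-d : ℝ) : ℂ) * ((ascPochhammer ℂ n).eval ((1 - d : ℝ) : ℂ))⁻¹) • z ^ n
      = -d / (n - d) * z ^ n := fun n => by
    have hfac : (ascPochhammer ℂ n).eval 1 = n.factorial := ascPochhammer_eval_one ℂ n
    have h1 := ascPochhammer_eval_mul_add ((-d : ℝ) : ℂ) n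
    have hP : (ascPochhammer ℂ n).eval ((1 - d : ℝ) : ℂ) ≠ 0 := by
      have : (ascPochhammer ℂ n).eval ((1 - d : ℝ) : ℂ)
          = (((ascPochhammer ℝ n).eval (1 - d) : ℝ) : ℂ) := by
        rw [← ascPochhammer_map Complex.ofRealHom, Polynomial.eval_map]
        exact Polynomial.eval₂_at_apply Complex.ofRealHom (1 - d)
      rw [this]
      exact_mod_cast (ascPochhammer_pos n (1 - d) (by linarith)).ne'
    have h2 : ((-d : ℝ) : ℂ) + 1 = ((1 - d : ℝ) : ℂ) := by push_cast; ring
    rw [h2] at h1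
    have h3 : ((-d : ℝ) : ℂ) + n = n - d := by push_cast; ring
    rw [h3] at h1
    have hn : (n.factorial : ℂ) ≠ 0 := by exact_mod_cast n.factorial_ne_zero
    rw [hfac, inv_mul_cancel₀ hn, one_mul, smul_eq_mul]
    congr 1
    rw [← div_eq_mul_inv, div_eq_div_iff hP (hne n), h1]
    push_cast; ring
  have hsum : HasSum (fun n : ℕ => -d / (n - d) * z ^ n) (1 - d * z * stieltjes d z) := by
    have h := ((hasSum_stieltjes hd1 hz).mul_left (-(d * z)))
    have h0 : (-d / ((0 : ℕ) - d) * z ^ 0 : ℂ) = 1 := by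
      have : (d : ℂ) ≠ 0 := by exact_mod_cast hd0.ne'
      simp [div_self this]
    rw [← hasSum_nat_add_iff' 1, Finset.sum_range_one, h0]
    have hfun : (fun n : ℕ => -d / ((n + 1 : ℕ) - d) * z ^ (n + 1) : ℕ → ℂ)
        = fun n : ℕ => -(d * z) * (z ^ n / (n + 1 - d)) := by
      ext n
      push_cast
      rw [pow_succ]; ring
    rw [hfun, show 1 - d * z * stieltjes d z - 1 = -(d * z) * stieltjes d z by ring]
    exact h
  rw [ordinaryHypergeometric_eq_tsum]
  simp_rw [hcoef]
  exact hsum.tsum_eq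

/-- Supplies the continuation explicitly, so that `gaussHypergeometric` takes its intended value
here and not the default `0`. -/
lemma isGaussHypergeometric_one_neg {d : ℝ} (hd0 : 0 < d) (hd1 : d < 1) :
    IsGaussHypergeometric 1 ((-d : ℝ) : ℂ) ((1 - d : ℝ) : ℂ)
      (fun z => 1 - d * z * stieltjes d z) := by
  refine ⟨?_, fun z hz => (ordinaryHypergeometric_one_neg hd0 hd1 (by simpa using hz)).symm⟩
  have := differentiableOn_stieltjes hd1
  fun_prop

lemma eta_one {α : ℝ} (hα : 2 < α) {s r : ℝ} (hs : 0 ≤ s) (hr : 0 < r) :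
    eta α s 1 r = 1 + 2 / α * (s / r ^ α) *
      ∫ w in Set.Ioo (0 : ℝ) 1, w ^ (-(2 / α)) / (1 + s / r ^ α * w) := by
  have hd0 : 0 < 2 / α := by positivity
  have hd1 : 2 / α < 1 := by rw [div_lt_one (by linarith)]; exact hα
  have hx : 0 ≤ s / r ^ α := div_nonneg hs (Real.rpow_nonneg hr.le _)
  have hz : ((-(s / r ^ α) : ℝ) : ℂ) ∈ cutPlane := by
    change (1 : ℂ) - _ ∈ Complex.slitPlane
    rw [← Complex.ofReal_one, ← Complex.ofReal_sub, Complex.ofReal_mem_slitPlane]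
    linarith
  rw [eta, one_mul, Complex.ofReal_one,
    gaussHypergeometric_eq (isGaussHypergeometric_one_neg hd0 hd1) hz]
  have hst : stieltjes (2 / α) ((-(s / r ^ α) : ℝ) : ℂ)
      = ((∫ w in Set.Ioo (0 : ℝ) 1, w ^ (-(2 / α)) / (1 + s / r ^ α * w) : ℝ) : ℂ) := by
    rw [stieltjes, ← integral_complex_ofReal]
    refine integral_congr_ae (.of_forall fun w => ?_)
    simp [div_eq_mul_inv]
  rw [hst, ← Complex.ofReal_one, ← Complex.ofReal_mul, ← Complex.ofReal_mul, ← Complex.ofReal_sub,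
    Complex.ofReal_re]
  ring

/-! ### The second Euler integral -/

/-- The Gamma integral in `[0, ∞]` form, as needed for Tonelli below. -/
lemma lintegral_rpow_mul_exp_neg_mul_Ioi {a r : ℝ} (ha : 0 < a) (hr : 0 < r) :
    ∫⁻ t in Set.Ioi 0, ENNReal.ofReal (t ^ (a - 1) * Real.exp (-(r * t)))
      = ENNReal.ofReal ((1 / r) ^ a * Real.Gamma a) := by
  have h := Real.integral_rpow_mul_exp_neg_mul_Ioi ha hr
  have hpos : 0 < (1 / r) ^ a * Real.Gamma a :=
    mul_pos (Real.rpow_pos_of_pos (by positivity) _) (Real.Gamma_pos_of_pos ha)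
  rw [← h, ofReal_integral_eq_lintegral_ofReal]
  · exact Integrable.of_integral_ne_zero (h ▸ hpos.ne')
  · filter_upwards [ae_restrict_mem measurableSet_Ioi] with t ht
    have := Real.rpow_nonneg (le_of_lt ht) (a - 1)
    simp only [Pi.zero_apply]
    positivity

/-- Write `1 / (1 + v) = ∫ exp (-(1 + v) y) dy` and swap by Tonelli: the `v`-integral gives `Γ(1 -
d) y ^ (d - 1)` and the remaining `y`-integral gives `Γ(d)`. -/
lemma lintegral_rpow_neg_div_one_add {d : ℝ} (hd0 : 0 < d) (hd1 : d < 1) :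
    ∫⁻ v in Set.Ioi (0 : ℝ), ENNReal.ofReal (v ^ (-d) / (1 + v))
      = ENNReal.ofReal (Real.Gamma d * Real.Gamma (1 - d)) := by
  calc ∫⁻ v in Set.Ioi (0 : ℝ), ENNReal.ofReal (v ^ (-d) / (1 + v))
      = ∫⁻ v in Set.Ioi (0 : ℝ), ∫⁻ y in Set.Ioi (0 : ℝ),
          ENNReal.ofReal (v ^ (-d)) * ENNReal.ofReal (Real.exp (-((1 + v) * y))) := by
        refine setLIntegral_congr_fun measurableSet_Ioi fun v hv => ?_
        have hv' : 0 < v := hv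
        have h1 := lintegral_rpow_mul_exp_neg_mul_Ioi one_pos (show 0 < 1 + v by linarith)
        simp only [sub_self, Real.rpow_zero, one_mul, Real.rpow_one, Real.Gamma_one,
          mul_one] at h1
        rw [lintegral_const_mul _ (by fun_prop), h1, ← ENNReal.ofReal_mul (by positivity)]
        congr 1; ring
    _ = ∫⁻ y in Set.Ioi (0 : ℝ), ∫⁻ v in Set.Ioi (0 : ℝ),
          ENNReal.ofReal (v ^ (-d)) * ENNReal.ofReal (Real.exp (-((1 + v) * y))) :=
        lintegral_lintegral_swap (Measurable.aemeasurable (by fun_prop))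
    _ = ∫⁻ y in Set.Ioi (0 : ℝ),
          ENNReal.ofReal (Real.Gamma (1 - d)) *
            ENNReal.ofReal (y ^ (d - 1) * Real.exp (-(1 * y))) := by
        refine setLIntegral_congr_fun measurableSet_Ioi fun y hy => ?_
        have hy' : 0 < y := hy
        have h1 := lintegral_rpow_mul_exp_neg_mul_Ioi (show 0 < 1 - d by linarith) hy'
        have h2 : ∀ v ∈ Set.Ioi (0 : ℝ),
            ENNReal.ofReal (v ^ (-d)) * ENNReal.ofReal (Real.exp (-((1 + v) * y)))
            = ENNReal.ofReal (Real.exp (-y)) *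
              ENNReal.ofReal (v ^ (1 - d - 1) * Real.exp (-(y * v))) := fun v hv => by
          have hv' : 0 < v := hv
          rw [← ENNReal.ofReal_mul (by positivity), ← ENNReal.ofReal_mul (by positivity),
            show -((1 + v) * y) = -y + -(y * v) by ring, Real.exp_add,
            show 1 - d - 1 = -d by ring]
          congr 1; ring
        have hG := (Real.Gamma_pos_of_pos (show 0 < 1 - d by linarith)).le
        rw [setLIntegral_congr_fun measurableSet_Ioi h2, lintegral_const_mul _ (by fun_prop), h1,
          ← ENNReal.ofReal_mul (by positivity), ← ENNReal.ofReal_mul hG, one_div,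
          Real.inv_rpow hy'.le, ← Real.rpow_neg hy'.le, neg_sub, one_mul]
        congr 1; ring
    _ = ENNReal.ofReal (Real.Gamma d * Real.Gamma (1 - d)) := by
        rw [lintegral_const_mul _ (by fun_prop),
          lintegral_rpow_mul_exp_neg_mul_Ioi hd0 one_pos,
          ← ENNReal.ofReal_mul (Real.Gamma_pos_of_pos (by linarith)).le]
        congr 1
        rw [div_one, Real.one_rpow]; ring

lemma rpow_neg_div_one_add_nonneg (d : ℝ) :
    0 ≤ᵐ[volume.restrict (Set.Ioi 0)] fun v : ℝ => v ^ (-d) / (1 + v) := by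
  filter_upwards [ae_restrict_mem measurableSet_Ioi] with v hv
  have hv' : 0 < v := hv
  simp only [Pi.zero_apply]
  positivity

lemma integrableOn_rpow_neg_div_one_add {d : ℝ} (hd0 : 0 < d) (hd1 : d < 1) :
    IntegrableOn (fun v : ℝ => v ^ (-d) / (1 + v)) (Set.Ioi 0) := by
  refine ⟨Measurable.aestronglyMeasurable (by fun_prop), ?_⟩
  rw [hasFiniteIntegral_iff_ofReal (rpow_neg_div_one_add_nonneg d),
    lintegral_rpow_neg_div_one_add hd0 hd1]
  exact ENNReal.ofReal_lt_top

lemma integral_rpow_neg_div_one_add {d : ℝ} (hd0 : 0 < d) (hd1 : d < 1) :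
    ∫ v in Set.Ioi (0 : ℝ), v ^ (-d) / (1 + v) = Real.Gamma d * Real.Gamma (1 - d) := by
  rw [integral_eq_lintegral_of_nonneg_ae (rpow_neg_div_one_add_nonneg d)
    (Measurable.aestronglyMeasurable (by fun_prop)), lintegral_rpow_neg_div_one_add hd0 hd1,
    ENNReal.toReal_ofReal (mul_pos (Real.Gamma_pos_of_pos hd0)
      (Real.Gamma_pos_of_pos (by linarith))).le]

/-! ### The integrals over the distance -/

/-- Prepares the substitution `w = t ^ (-α)`: the first factor is its Jacobian, and `t ^ 2 = w ^
(-(2 / α))`. -/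
lemma fading_integrand_eq {α s t : ℝ} (hα : 0 < α) (hs : 0 < s) (ht : 0 < t) :
    (1 - 1 / (1 + s * t ^ (-α))) * t
      = (|-α| * t ^ (-α - 1)) * (s / α * ((t ^ (-α)) ^ (-(2 / α)) / (1 + s * t ^ (-α)))) := by
  have hw : 0 < t ^ (-α) := Real.rpow_pos_of_pos ht _
  have h1 : (t ^ (-α)) ^ (-(2 / α)) = t ^ 2 := by
    rw [← Real.rpow_mul ht.le, ← Real.rpow_two]
    congr 1; field_simp
  have h2 : t ^ (-α - 1) = t ^ (-α) / t := by rw [Real.rpow_sub ht, Real.rpow_one]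
  rw [h1, h2, abs_neg, abs_of_pos hα]
  field_simp
  ring

lemma integrableOn_fading {α s : ℝ} (hα : 2 < α) (hs : 0 < s) :
    IntegrableOn (fun t : ℝ => (1 - 1 / (1 + s * t ^ (-α))) * t) (Set.Ioi 0) := by
  have hd0 : 0 < 2 / α := by positivity
  have hd1 : 2 / α < 1 := by rw [div_lt_one (by linarith)]; exact hα
  have h1 := (integrableOn_Ioi_comp_mul_left_iff (fun v : ℝ => v ^ (-(2 / α)) / (1 + v)) 0 hs).2
    (by rw [mul_zero]; exact integrableOn_rpow_neg_div_one_add hd0 hd1)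
  have h2 : IntegrableOn (fun w : ℝ => s / α * (w ^ (-(2 / α)) / (1 + s * w))) (Set.Ioi 0) := by
    refine IntegrableOn.congr_fun (h1.const_mul (s / α * s ^ (2 / α))) (fun w hw => ?_)
      measurableSet_Ioi
    have hw' : 0 < w := hw
    have h3 : s ^ (2 / α) * s ^ (-(2 / α)) = 1 := by
      rw [← Real.rpow_add hs, add_neg_cancel, Real.rpow_zero]
    rw [Real.mul_rpow hs.le hw'.le]
    linear_combination (s / α * (w ^ (-(2 / α)) / (1 + s * w))) * h3
  have h4 := (integrableOn_Ioi_comp_rpow_iff _ (show -α ≠ 0 by linarith)).2 h2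
  refine h4.congr_fun (fun t ht => ?_) measurableSet_Ioi
  exact (fading_integrand_eq (by linarith) hs ht).symm

lemma integral_fading_zero {α s : ℝ} (hα : 2 < α) (hs : 0 < s) :
    ∫ t in Set.Ioi (0 : ℝ), (1 - 1 / (1 + s * t ^ (-α))) * t = zeta α 1 * s ^ (2 / α) := by
  have hd0 : 0 < 2 / α := by positivity
  have hd1 : 2 / α < 1 := by rw [div_lt_one (by linarith)]; exact hα
  have h1 := integral_comp_rpow_Ioi (fun w : ℝ => s / α * (w ^ (-(2 / α)) / (1 + s * w)))
    (show -α ≠ 0 by linarith)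
  have h2 : ∫ w in Set.Ioi (0 : ℝ), s / α * (w ^ (-(2 / α)) / (1 + s * w))
      = ∫ w in Set.Ioi (0 : ℝ), s / α * s ^ (2 / α) * ((s * w) ^ (-(2 / α)) / (1 + s * w)) := by
    refine setIntegral_congr_fun measurableSet_Ioi fun w hw => ?_
    have hw' : 0 < w := hw
    have h3 : s ^ (2 / α) * s ^ (-(2 / α)) = 1 := by
      rw [← Real.rpow_add hs, add_neg_cancel, Real.rpow_zero]
    rw [Real.mul_rpow hs.le hw'.le]
    linear_combination -(s / α * (w ^ (-(2 / α)) / (1 + s * w))) * h3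
  have h5 := integral_comp_mul_left_Ioi (fun v : ℝ => v ^ (-(2 / α)) / (1 + v)) 0 hs
  rw [mul_zero, integral_rpow_neg_div_one_add hd0 hd1, smul_eq_mul] at h5
  rw [setIntegral_congr_fun measurableSet_Ioi
    fun t ht => fading_integrand_eq (by linarith) hs ht]
  simp only [smul_eq_mul] at h1
  rw [h1, h2, integral_const_mul, h5, zeta]
  -- Two uses of `Γ(x + 1) = x Γ(x)` turn `Γ(d) Γ(1 - d)` into `-Γ(1 + d) Γ(-d)`.
  have hG1 : Real.Gamma (1 + 2 / α) = 2 / α * Real.Gamma (2 / α) := by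
    rw [add_comm, Real.Gamma_add_one hd0.ne']
  have hG2 : Real.Gamma (1 - 2 / α) = -(2 / α) * Real.Gamma (-(2 / α)) := by
    rw [← Real.Gamma_add_one (by linarith), neg_add_eq_sub]
  rw [hG1, hG2, Real.Gamma_one]
  field_simp

lemma integral_fading_one {α s : ℝ} (hα : 2 < α) (hs : 0 < s) :
    ∫ t in Set.Ioi (1 : ℝ), (1 - 1 / (1 + s * t ^ (-α))) * t
      = s / α * ∫ w in Set.Ioo (0 : ℝ) 1, w ^ (-(2 / α)) / (1 + s * w) := by
  let K : ℝ → ℝ := fun w => s / α * (w ^ (-(2 / α)) / (1 + s * w))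
  -- The change of variables covers the whole half-line; the indicator carries `t > 1` over to `w <
  -- 1`.
  have h1 := integral_comp_rpow_Ioi ((Set.Iio 1).indicator K) (show -α ≠ 0 by linarith)
  have h2 : ∫ t in Set.Ioi (0 : ℝ), (|-α| * t ^ (-α - 1)) • (Set.Iio 1).indicator K (t ^ (-α))
      = ∫ t in Set.Ioi (0 : ℝ),
        (Set.Ioi 1).indicator (fun t => (1 - 1 / (1 + s * t ^ (-α))) * t) t := by
    refine setIntegral_congr_fun measurableSet_Ioi fun t ht => ?_
    have ht' : 0 < t := ht
    have hiff : t ^ (-α) ∈ Set.Iio 1 ↔ t ∈ Set.Ioi 1 := by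
      simp only [Set.mem_Iio, Set.mem_Ioi]
      rw [Real.rpow_lt_one_iff_of_pos ht']
      constructor
      · rintro (h | h)
        · exact h.1
        · linarith [h.2]
      · intro h; exact Or.inl ⟨h, by linarith⟩
    by_cases h : t ∈ Set.Ioi 1
    · rw [Set.indicator_of_mem h, Set.indicator_of_mem (hiff.2 h), smul_eq_mul,
        fading_integrand_eq (by linarith) hs ht']
    · rw [Set.indicator_of_notMem h, Set.indicator_of_notMem (fun h' => h (hiff.1 h')), smul_zero]
  rw [h2, setIntegral_indicator measurableSet_Ioi, setIntegral_indicator measurableSet_Iio,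
    Set.Ioi_inter_Ioi, Set.Ioi_inter_Iio, max_eq_right zero_le_one] at h1
  rw [h1, integral_const_mul]

lemma integral_fading_scale {α s a : ℝ} (ha : 0 < a) :
    ∫ t in Set.Ioi a, (1 - 1 / (1 + s * t ^ (-α))) * t
      = a ^ 2 * ∫ t in Set.Ioi (1 : ℝ), (1 - 1 / (1 + s / a ^ α * t ^ (-α))) * t := by
  have h := integral_comp_mul_left_Ioi' (fun t : ℝ => (1 - 1 / (1 + s * t ^ (-α))) * t) 1 ha
  rw [mul_one, smul_eq_mul] at h
  rw [← h, pow_two, mul_assoc]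
  congr 1
  rw [← integral_const_mul]
  refine setIntegral_congr_fun measurableSet_Ioi fun t ht => ?_
  have ht' : 0 < t := one_pos.trans ht
  rw [Real.mul_rpow ha.le ht'.le, Real.rpow_neg ha.le, div_eq_mul_inv s, mul_assoc s]
  ring

/-- The substitution `u ^ 2 = t ^ 2 + h ^ 2`. -/
lemma integral_fading_elevated {α s a h : ℝ} (ha : 0 ≤ a) :
    (∫ t in Set.Ioi a, (1 - 1 / (1 + s * pathloss α h t)) * t)
      = ∫ t in Set.Ioi √(a ^ 2 + h ^ 2), (1 - 1 / (1 + s * t ^ (-α))) * t := by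
  let K : ℝ → ℝ := fun u => 1 - 1 / (1 + s * u ^ (-(α / 2)))
  have hsq : ∀ (f : ℝ → ℝ) {c : ℝ}, 0 ≤ c →
      ∫ t in Set.Ioi √c, f (t ^ 2) * t = 1 / 2 * ∫ y in Set.Ioi c, f y := fun f c hc => by
    have h := integral_comp_rpow_Ioi_of_pos' (g := f) (p := 2) two_pos hc
    rw [← h, ← integral_const_mul, ← one_div, ← Real.sqrt_eq_rpow]
    refine setIntegral_congr_fun measurableSet_Ioi fun t _ => ?_
    have h1 : t ^ ((2 : ℝ) - 1) = t := by norm_num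
    simp only [smul_eq_mul, Real.rpow_two, h1]
    ring
  have hshift := (measurePreserving_add_right (volume : Measure ℝ) (h ^ 2)).setIntegral_preimage_emb
    (MeasurableEquiv.addRight (h ^ 2)).measurableEmbedding K (Set.Ioi (a ^ 2 + h ^ 2))
  rw [Set.preimage_add_const_Ioi, add_sub_cancel_right] at hshift
  have h1 := hsq (fun y => K (y + h ^ 2)) (sq_nonneg a)
  rw [Real.sqrt_sq ha, hshift, ← hsq K (by positivity)] at h1
  refine h1.trans (setIntegral_congr_fun measurableSet_Ioi fun t ht => ?_)
  have ht' : 0 < t := (Real.sqrt_nonneg _).trans_lt ht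
  have h2 : (t ^ 2) ^ (-(α / 2)) = t ^ (-α) := by
    rw [← Real.rpow_two, ← Real.rpow_mul ht'.le]
    congr 1; ring
  simp only [K, h2]

lemma fading_nonneg {α s t : ℝ} (hs : 0 ≤ s) (ht : 0 ≤ t) :
    0 ≤ (1 - 1 / (1 + s * t ^ (-α))) * t := by
  have h1 := mul_nonneg hs (Real.rpow_nonneg ht (-α))
  refine mul_nonneg ?_ ht
  rw [sub_nonneg, div_le_one (by positivity)]
  linarith

lemma integral_fading {α s a : ℝ} (hα : 2 < α) (hs : 0 < s) (ha : 0 < a) :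
    ∫ t in Set.Ioi a, (1 - 1 / (1 + s * t ^ (-α))) * t = a ^ 2 / 2 * (eta α s 1 a - 1) := by
  rw [integral_fading_scale ha,
    integral_fading_one hα (div_pos hs (Real.rpow_pos_of_pos ha _)), eta_one hα hs.le ha]
  ring

lemma pathloss_le {α h t : ℝ} (hα : 0 ≤ α) (ht : 0 < t) : pathloss α h t ≤ t ^ (-α) := by
  have h1 : t ^ (-α) = (t ^ 2) ^ (-(α / 2)) := by
    rw [← Real.rpow_two, ← Real.rpow_mul ht.le]
    congr 1; ring
  rw [h1, pathloss]
  exact Real.rpow_le_rpow_of_nonpos (by positivity) (by linarith [sq_nonneg h]) (by linarith)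

lemma integrableOn_fading_elevated {α s h : ℝ} (hα : 2 < α) (hs : 0 < s) :
    IntegrableOn (fun t => (1 - 1 / (1 + s * pathloss α h t)) * t) (Set.Ioi 0) := by
  refine Integrable.mono' (integrableOn_fading hα hs)
    (Measurable.aestronglyMeasurable (by unfold pathloss; fun_prop)) ?_
  filter_upwards [ae_restrict_mem measurableSet_Ioi] with t ht
  have ht' : 0 < t := ht
  have h1 := mul_nonneg hs.le (pathloss_nonneg α h t)
  have h2 := mul_le_mul_of_nonneg_left (pathloss_le (h := h) (by linarith : 0 ≤ α) ht') hs.le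
  have h3 : 0 ≤ 1 - 1 / (1 + s * pathloss α h t) := by
    rw [sub_nonneg, div_le_one (by positivity)]; linarith
  rw [Real.norm_of_nonneg (mul_nonneg h3 ht'.le)]
  gcongr

/-! ### From distance integrals to Laplace transforms. -/

lemma nu_nonneg (q : Association) {r : ℝ} (hr : 0 ≤ r) : 0 ≤ nu q r := by
  cases q
  · exact hr
  · exact le_rfl

lemma laplaceIntegral_eq (lam α s h : ℝ) (q : Association) {r : ℝ} (hr : 0 ≤ r) :
    laplaceIntegral lam α h q r s = Real.exp (-2 * Real.pi * lam *
      ∫ t in Set.Ioi √(nu q r ^ 2 + h ^ 2), (1 - 1 / (1 + s * t ^ (-α))) * t) := by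
  rw [laplaceIntegral, integral_fading_elevated (nu_nonneg q hr)]

/-- Lowering the limit of integration to `0` enlarges the integral of a nonnegative function. The
bound tends to `1` as `s → 0`, which forces almost sure finiteness. -/
lemma exp_le_laplaceIntegral {lam α s h : ℝ} {q : Association} {r : ℝ} (hlam : 0 < lam)
    (hα : 2 < α) (hs : 0 < s) (hr : 0 ≤ r) :
    Real.exp (-2 * Real.pi * lam * (zeta α 1 * s ^ (2 / α))) ≤ laplaceIntegral lam α h q r s := by
  rw [laplaceIntegral_eq lam α s h q hr, ← integral_fading_zero hα hs, Real.exp_le_exp]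
  refine mul_le_mul_of_nonpos_left (setIntegral_mono_set (integrableOn_fading hα hs) ?_
    (Set.Ioi_subset_Ioi (Real.sqrt_nonneg _)).eventuallyLE) ?_
  · filter_upwards [ae_restrict_mem measurableSet_Ioi] with t ht
    exact fading_nonneg hs.le (le_of_lt ht)
  · have := mul_pos Real.pi_pos hlam
    linarith

lemma laplaceTransform_le_zero {Ω : Type*} [MeasurableSpace Ω] {P : Measure Ω}
    [IsProbabilityMeasure P] {X : Ω → ℝ≥0∞} (hX : Measurable X) {s : ℝ} (hs : 0 ≤ s) :
    laplaceTransform P X s ≤ laplaceTransform P X 0 ∧ laplaceTransform P X 0 ≤ 1 := by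
  classical
  have hle : ∀ u : ℝ, 0 ≤ u → ∀ ω,
      0 ≤ (if X ω = ∞ then 0 else Real.exp (-u * (X ω).toReal)) ∧
        (if X ω = ∞ then 0 else Real.exp (-u * (X ω).toReal)) ≤ 1 := fun u hu ω => by
    split_ifs
    · simp
    · exact ⟨Real.exp_nonneg _, Real.exp_le_one_iff.2 (by
        rw [neg_mul, neg_nonpos]; exact mul_nonneg hu ENNReal.toReal_nonneg)⟩
  have hint : ∀ u : ℝ, 0 ≤ u →
      Integrable (fun ω => if X ω = ∞ then 0 else Real.exp (-u * (X ω).toReal)) P := fun u hu => by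
    refine Integrable.of_bound (C := 1) (Measurable.aestronglyMeasurable ?_)
      (.of_forall fun ω => ?_)
    · exact Measurable.ite (hX (measurableSet_singleton ∞)) measurable_const (by fun_prop)
    · rw [Real.norm_of_nonneg (hle u hu ω).1]
      exact (hle u hu ω).2
  constructor
  · refine integral_mono (hint s hs) (hint 0 le_rfl) fun ω => ?_
    dsimp only
    split_ifs
    · exact le_rfl
    · rw [Real.exp_le_exp, neg_zero, zero_mul, neg_mul, neg_nonpos]
      exact mul_nonneg hs ENNReal.toReal_nonneg
  · calc laplaceTransform P X 0 ≤ ∫ _, (1 : ℝ) ∂P :=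
          integral_mono (hint 0 le_rfl) (integrable_const _) fun ω => (hle 0 le_rfl ω).2
      _ = 1 := by simp

namespace IsRayleighNetwork

variable {Ω : Type*} [MeasurableSpace Ω] {P : Measure Ω} {lam : ℝ}
  {x : ℕ → Ω → Plane} {g : ℕ → Ω → ℝ}

/-- The interference is almost surely finite. -/
lemma laplaceTransform_interference_zero [IsProbabilityMeasure P]
    (hnet : IsRayleighNetwork P lam x g) (hlam : 0 < lam) {α : ℝ} (hα : 2 < α) (h : ℝ)
    (q : Association) {r : ℝ} (hr : 0 ≤ r) :
    laplaceTransform P (interference x g α h q r) 0 = 1 := by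
  have hm := hnet.measurable_interference α h q r
  refine le_antisymm (laplaceTransform_le_zero hm le_rfl).2 ?_
  have hlim : Tendsto (fun s : ℝ => Real.exp (-2 * Real.pi * lam * (zeta α 1 * s ^ (2 / α))))
      (𝓝[>] 0) (𝓝 1) := by
    have hc : Continuous fun s : ℝ =>
        Real.exp (-2 * Real.pi * lam * (zeta α 1 * s ^ (2 / α))) := by
      have := Real.continuous_rpow_const (q := 2 / α) (by positivity)
      fun_prop
    have h0 := (hc.tendsto 0).mono_left (nhdsWithin_le_nhds (s := Set.Ioi 0))
    have h1 : 2 / α ≠ 0 := by positivity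
    simpa [Real.zero_rpow h1] using h0
  -- For each `s > 0` the bound is at most the transform at `s`, hence at most the transform at `0`,
  -- the probability that the interference is finite.
  refine le_of_tendsto hlim ?_
  filter_upwards [self_mem_nhdsWithin] with s hs
  have heq := hnet.laplaceTransform_interference hlam (nu_nonneg q hr) hs
    ((integrableOn_fading_elevated (h := h) hα hs).mono_set
      (Set.Ioi_subset_Ioi (nu_nonneg q hr)))
  exact ((exp_le_laplaceIntegral hlam hα hs hr).trans heq.ge).trans
    (laplaceTransform_le_zero hm (le_of_lt hs)).1

lemma laplaceTransform_eq_laplaceIntegral [IsProbabilityMeasure P]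
    (hnet : IsRayleighNetwork P lam x g) (hlam : 0 < lam) {α : ℝ} (hα : 2 < α) (h : ℝ)
    (q : Association) {r s : ℝ} (hr : 0 ≤ r) (hs : 0 ≤ s) :
    laplaceTransform P (interference x g α h q r) s = laplaceIntegral lam α h q r s := by
  -- At `s = 0` the identity is exactly almost sure finiteness.
  rcases hs.eq_or_lt with rfl | hs
  · rw [hnet.laplaceTransform_interference_zero hlam hα h q hr]
    simp [laplaceIntegral]
  · exact hnet.laplaceTransform_interference hlam (nu_nonneg q hr) hs
      ((integrableOn_fading_elevated hα hs).mono_set (Set.Ioi_subset_Ioi (nu_nonneg q hr)))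

end IsRayleighNetwork

lemma exp_integral_fading {α s a : ℝ} (lam : ℝ) (hα : 2 < α) (hs : 0 ≤ s) (ha : 0 < a) :
    Real.exp (-2 * Real.pi * lam * ∫ t in Set.Ioi a, (1 - 1 / (1 + s * t ^ (-α))) * t)
      = Real.exp (-Real.pi * lam * a ^ 2 * (eta α s 1 a - 1)) := by
  rcases hs.eq_or_lt with rfl | hs
  · simp [eta_one hα le_rfl ha]
  · rw [integral_fading hα hs ha]
    congr 1; ring

lemma laplaceIntegral_zero_height {lam α s r : ℝ} (hα : 2 < α) (hs : 0 ≤ s) (hr : 0 < r)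
    (q : Association) : laplaceIntegral lam α 0 q r s = laplaceNonElevated lam α q r s := by
  rw [laplaceIntegral_eq lam α s 0 q hr.le, zero_pow two_ne_zero, add_zero,
    Real.sqrt_sq (nu_nonneg q hr.le)]
  cases q
  · exact exp_integral_fading lam hα hs hr
  · rw [laplaceNonElevated, nu, mul_assoc (-2 * Real.pi * lam)]
    rcases hs.eq_or_lt with rfl | hs
    · have h1 : 2 / α ≠ 0 := by positivity
      simp [Real.zero_rpow h1]
    · rw [integral_fading_zero hα hs]

lemma laplaceIntegral_eq_mul {lam α s h r : ℝ} (hα : 2 < α) (hs : 0 ≤ s) (hr : 0 < r)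
    (q : Association) : laplaceIntegral lam α h q r s = laplaceNonElevated lam α q r s *
      Real.exp (2 * Real.pi * lam *
        ∫ t in nu q r..√(nu q r ^ 2 + h ^ 2), (1 - 1 / (1 + s * t ^ (-α))) * t) := by
  rw [← laplaceIntegral_zero_height hα hs hr, laplaceIntegral_eq lam α s 0 q hr.le,
    laplaceIntegral_eq lam α s h q hr.le, zero_pow two_ne_zero, add_zero,
    Real.sqrt_sq (nu_nonneg q hr.le), ← Real.exp_add]
  rcases hs.eq_or_lt with rfl | hs
  · simp
  · rw [← intervalIntegral.integral_interval_add_Ioi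
      ((integrableOn_fading hα hs).mono_set (Set.Ioi_subset_Ioi (nu_nonneg q hr.le)))
      ((integrableOn_fading hα hs).mono_set
        (Set.Ioi_subset_Ioi (Real.sqrt_nonneg (nu q r ^ 2 + h ^ 2))))]
    congr 1; ring

end ElevatedBS

end

theorem mainTheorem8 {Ω : Type*} [MeasurableSpace Ω] (P : Measure Ω) [IsProbabilityMeasure P]
    (lam α : ℝ) (hlam : 0 < lam) (hα : 2 < α)
    (x : ℕ → Ω → ElevatedBS.Plane) (g : ℕ → Ω → ℝ)
    (hnet : ElevatedBS.IsRayleighNetwork P lam x g)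
    (h r s : ℝ) (hh : 0 < h) (hr : 0 < r) (hs : 0 ≤ s) :
    -- the Laplace transforms of the interference with non-elevated base stations
    (∀ q, ElevatedBS.laplaceTransform P (ElevatedBS.interference x g α 0 q r) s
        = ElevatedBS.laplaceNonElevated lam α q r s) ∧
    -- the Laplace transforms of the interference with elevated base stations, as integrals
    (∀ q, ElevatedBS.laplaceTransform P (ElevatedBS.interference x g α h q r) s
        = ElevatedBS.laplaceIntegral lam α h q r s) ∧
    -- closest association
    (ElevatedBS.laplaceTransform P (ElevatedBS.interference x g α h .closest r) s
        = ElevatedBS.laplaceNonElevated lam α .closest r s *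
          Real.exp (2 * Real.pi * lam *
            ∫ t in r..√(r ^ 2 + h ^ 2), (1 - 1 / (1 + s * t ^ (-α))) * t)) ∧
    (ElevatedBS.laplaceTransform P (ElevatedBS.interference x g α h .closest r) s
        = Real.exp (-Real.pi * lam * (r ^ 2 + h ^ 2) *
            (ElevatedBS.eta α s 1 (√(r ^ 2 + h ^ 2)) - 1))) ∧
    -- strongest association
    (ElevatedBS.laplaceTransform P (ElevatedBS.interference x g α h .strongest r) s
        = ElevatedBS.laplaceNonElevated lam α .strongest r s *
          Real.exp (2 * Real.pi * lam *
            ∫ t in (0 : ℝ)..h, (1 - 1 / (1 + s * t ^ (-α))) * t)) ∧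
    (ElevatedBS.laplaceTransform P (ElevatedBS.interference x g α h .strongest r) s
        = Real.exp (-Real.pi * lam * h ^ 2 * (ElevatedBS.eta α s 1 h - 1))) := by
  have hI := fun H q => hnet.laplaceTransform_eq_laplaceIntegral hlam hα H q hr.le hs
  refine ⟨fun q => ?_, fun q => hI h q, ?_, ?_, ?_, ?_⟩
  · rw [hI, ElevatedBS.laplaceIntegral_zero_height hα hs hr]
  · rw [hI, ElevatedBS.laplaceIntegral_eq_mul hα hs hr, ElevatedBS.nu]
  · rw [hI, ElevatedBS.laplaceIntegral_eq lam α s h _ hr.le, ElevatedBS.nu,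
      ElevatedBS.exp_integral_fading lam hα hs (by positivity), Real.sq_sqrt (by positivity)]
  · rw [hI, ElevatedBS.laplaceIntegral_eq_mul hα hs hr, ElevatedBS.nu, zero_pow two_ne_zero,
      zero_add, Real.sqrt_sq hh.le]
  · rw [hI, ElevatedBS.laplaceIntegral_eq lam α s h _ hr.le, ElevatedBS.nu,
      zero_pow two_ne_zero, zero_add, Real.sqrt_sq hh.le,
      ElevatedBS.exp_integral_fading lam hα hs hh]
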